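/- All graphs are finite and simple. For an acyclic digraph $D$, its competition graph $C(D)$ is the graph on the vertex set of $D$ in which two distinct vertices $x,y$ are adjacent if and only if there is a vertex $v$ such that $(x,v)$ and $(y,v)$ are arcs of $D$. The competition number $k(G)$ of a graph $G$ is the smallest integer $k\ge 0$ such that $G$ together with $k$ additional isolated vertices is the competition graph of an acyclic digraph. A hole of $G$ is an induced subgraph of $G$ that is a cycle of length at least $4$; $G$ is chordal if it has no hole. For a hole $C$, let $\chi_C\in\mathbb{F}_2^{E(G)}$ be the characteristic vector of its edge set, and let $\mathcal{H}(G)=\operatorname{Span}\{\chi_C : C \text{ is a hole of } G\}\subseteq\mathbb{F}_2^{E(G)}$ be the hole space of $G$. **Proposition.** If a graph $G$ has at most two holes, then $$k(G)\le \dim_{\mathbb{F}_2}\mathcal{H}(G)+1.$$ Moreover, equality holds if $G$ is a chordal graph with at least one vertex and without isolated vertices. -/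

import Mathlib

open scoped SimpleGraph

/-- A digraph is acyclic if it has no directed cycle; a loop counts as a directed cycle. -/
def Digraph.IsAcyclic {W : Type*} (D : Digraph W) : Prop :=
  ∀ v : W, ¬ Relation.TransGen D.Adj v v

/-- The competition graph of a digraph: two distinct vertices are adjacent iff they have a
common out-neighbour. -/
def Digraph.competitionGraph {W : Type*} (D : Digraph W) : SimpleGraph W where
  Adj x y := x ≠ y ∧ ∃ v : W, D.Adj x v ∧ D.Adj y v
  symm := ⟨fun _ _ h => ⟨h.1.symm, h.2.imp fun _ hv => ⟨hv.2, hv.1⟩⟩⟩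
  loopless := ⟨fun _ h => h.1 rfl⟩

namespace SimpleGraph

/-- `G` together with `k` isolated vertices is the competition graph of an acyclic digraph. -/
def IsCompetitionGraphWith {V : Type*} (G : SimpleGraph V) (k : ℕ) : Prop :=
  ∃ D : Digraph (V ⊕ Fin k), D.IsAcyclic ∧ D.competitionGraph = G ⊕g (⊥ : SimpleGraph (Fin k))

/-- For a finite graph, some number of isolated vertices suffices: one for each edge. -/
theorem exists_isCompetitionGraphWith {V : Type*} [Finite V] (G : SimpleGraph V) :
    ∃ k : ℕ, G.IsCompetitionGraphWith k := by
  classical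
  obtain ⟨k, ⟨f⟩⟩ := Finite.exists_equiv_fin G.edgeSet
  let A : V ⊕ Fin k → V ⊕ Fin k → Prop := fun a b =>
    ∃ (x : V) (i : Fin k), a = Sum.inl x ∧ b = Sum.inr i ∧ x ∈ ((f.symm i : G.edgeSet) : Sym2 V)
  refine ⟨k, ⟨A⟩, ?_, ?_⟩
  · have key : ∀ a b, Relation.TransGen A a b → (∃ x, a = Sum.inl x) ∧ ∃ i, b = Sum.inr i := by
      intro a b h
      induction h with
      | single h =>
        obtain ⟨x, i, h1, h2, -⟩ := h
        exact ⟨⟨x, h1⟩, i, h2⟩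
      | tail _ h ih =>
        obtain ⟨x, i, -, h2, -⟩ := h
        exact ⟨ih.1, i, h2⟩
    intro v hv
    obtain ⟨⟨x, hx⟩, i, hi⟩ := key v v hv
    rw [hx] at hi
    cases hi
  · ext a b
    constructor
    · rintro ⟨hne, c, ⟨x, i, rfl, rfl, hx⟩, ⟨y, j, rfl, hj, hy⟩⟩
      obtain rfl : i = j := Sum.inr_injective hj
      have hxy : x ≠ y := fun h => hne (by rw [h])
      have h := (f.symm i).2
      rw [(Sym2.mem_and_mem_iff hxy).1 ⟨hx, hy⟩] at h
      exact h
    · intro h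
      rcases a with x | i <;> rcases b with y | j
      · have hxy : G.Adj x y := h
        refine ⟨fun e => hxy.ne (Sum.inl_injective e), Sum.inr (f ⟨s(x, y), hxy⟩),
          ⟨x, _, rfl, rfl, ?_⟩, ⟨y, _, rfl, rfl, ?_⟩⟩ <;> simp
      · simp at h
      · simp at h
      · simp at h

/-- The competition number `k(G)`: the least `k` such that `G` together with `k` isolated
vertices is the competition graph of an acyclic digraph. -/
noncomputable def competitionNumber {V : Type*} (G : SimpleGraph V) : ℕ :=
  sInf {k : ℕ | G.IsCompetitionGraphWith k}

/-- For a finite graph the minimum defining `k(G)` is attained. -/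
theorem isLeast_competitionNumber {V : Type*} [Finite V] (G : SimpleGraph V) :
    IsLeast {k : ℕ | G.IsCompetitionGraphWith k} G.competitionNumber :=
  ⟨Nat.sInf_mem G.exists_isCompetitionGraphWith, fun _ hk => Nat.sInf_le hk⟩

/-- A hole of `G`: an induced subgraph of `G` which is a cycle of length at least `4`. -/
def IsHole {V : Type*} (G : SimpleGraph V) (C : G.Subgraph) : Prop :=
  C.IsInduced ∧ ∃ (v : V) (w : G.Walk v v), w.IsCycle ∧ 4 ≤ w.length ∧ w.toSubgraph = C

/-- The set `H(G)` of all holes of `G`. -/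
def holes {V : Type*} (G : SimpleGraph V) : Set G.Subgraph :=
  {C | G.IsHole C}

/-- A graph is chordal if it has no hole. -/
def IsChordal {V : Type*} (G : SimpleGraph V) : Prop :=
  ∀ C : G.Subgraph, ¬ G.IsHole C

/-- The characteristic vector over `𝔽₂` of the edge set of a subgraph. -/
noncomputable def edgeVector {V : Type*} (G : SimpleGraph V) (C : G.Subgraph) :
    G.edgeSet → ZMod 2 :=
  open Classical in fun e => if (e : Sym2 V) ∈ C.edgeSet then 1 else 0

/-- The hole space of `G`: the span over `𝔽₂` of the characteristic vectors of the holes. -/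
noncomputable def holeSpace {V : Type*} (G : SimpleGraph V) :
    Submodule (ZMod 2) (G.edgeSet → ZMod 2) :=
  Submodule.span (ZMod 2) (G.edgeVector '' G.holes)

end SimpleGraph

/-!
The bound `k(G) ≤ dim H(G) + 1` holds for every finite graph, whatever the number of its holes,
and is proved by deleting vertices one at a time.

The combinatorial core is `SimpleGraph.exists_avoidable`, a version of Dirac's theorem on
simplicial vertices for arbitrary graphs: there is a vertex `r` such that any two non-adjacent
neighbours `p`, `q` of `r` are joined by a walk otherwise avoiding the closed neighbourhood of `r`.
A shortest such walk closes up through `r` to a hole whose edges at `r` are exactly `rp` and `rq`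
(`SimpleGraph.exists_isHole_of_walk`).

Let `W` be the projection of the hole space to the edges at `r`, and `d` its dimension. Identifying
the edges at `r` with the neighbours of `r`, every non-adjacent pair `p`, `q` of neighbours
satisfies `e_p - e_q ∈ W`. The relation `e_p - e_q ∈ W` is an equivalence relation whose classes
have at most `d + 1` elements, so `d + 1` colours suffice to separate all related pairs
(`Submodule.exists_coloring_of_single_sub_single_mem`). Each colour class of neighbours is then a
clique, and the edges at `r` are covered by `d + 1` cliques.

If `G - r` with `m + 1` isolated vertices is a competition graph, then so is `G` with `m + d + 1` of
them: `r` replaces one isolated vertex and each of the `d + 1` cliques receives a new common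
out-neighbour (`SimpleGraph.HasCompetitionModel.insert_vertex`). Since holes avoiding `r` project
to zero in `W`, rank-nullity gives `dim H(G - r) + d ≤ dim H(G)`
(`SimpleGraph.finrank_holeSpaceOn_diff_add_le`), so the bound passes from `G - r` to `G`.

For a chordal graph the hole space is zero, and equality says `k(G) ≥ 1`: a sink of an acyclic
digraph is isolated in its competition graph (`SimpleGraph.competitionNumber_pos`).
-/

namespace SimpleGraph

variable {V : Type*} {G : SimpleGraph V}

/-! ### Avoidable vertices and holes through them -/

/-- A walk of minimal length among those with vertices in `T` is an induced path. -/
theorem Walk.mem_edges_of_adj_of_length_le {p q : V} {T : Set V} (w : G.Walk p q)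
    (hw : ∀ x ∈ w.support, x ∈ T)
    (hmin : ∀ w' : G.Walk p q, (∀ x ∈ w'.support, x ∈ T) → w.length ≤ w'.length)
    {a b : V} (ha : a ∈ w.support) (hb : b ∈ w.support) (hab : G.Adj a b) :
    s(a, b) ∈ w.edges := by
  obtain ⟨i, rfl, hi⟩ := Walk.mem_support_iff_exists_getVert.1 ha
  obtain ⟨j, rfl, hj⟩ := Walk.mem_support_iff_exists_getVert.1 hb
  have key : ∀ i j, i < j → j ≤ w.length → G.Adj (w.getVert i) (w.getVert j) →
      s(w.getVert i, w.getVert j) ∈ w.edges := by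
    intro i j hij hj h
    -- A chord from position `i` to position `j` gives a shortcut, so `j = i + 1`.
    have h1 := hmin ((w.take i).append (Walk.cons h (w.drop j))) (by
      intro x hx
      rw [Walk.mem_support_append_iff, Walk.support_cons, List.mem_cons] at hx
      apply hw
      rcases hx with hx | rfl | hx
      · rw [Walk.support_take] at hx
        exact List.mem_of_mem_take hx
      · exact Walk.getVert_mem_support _ _
      · rw [Walk.drop_support_eq_support_drop_min] at hx
        exact List.mem_of_mem_drop hx)
    simp only [Walk.length_append, Walk.take_length, Walk.length_cons, Walk.drop_length] at h1
    obtain rfl : j = i + 1 := by omega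
    rw [← Walk.mem_edges_toSubgraph, Subgraph.mem_edgeSet]
    exact w.toSubgraph_adj_getVert (by omega)
  rcases lt_trichotomy i j with h | h | h
  · exact key i j h hj hab
  · subst h
    exact absurd rfl hab.ne
  · rw [Sym2.eq_swap]
    exact key j i h hi hab.symm

/-- Two non-adjacent neighbours `p`, `q` of `r` joined by a walk that otherwise avoids the closed
neighbourhood of `r` lie, together with `r`, on a hole: close up a shortest such walk through
`r`. -/
theorem exists_isHole_of_walk {U : Set V} {r p q : V} (hr : r ∈ U) (hrp : G.Adj r p)
    (hrq : G.Adj r q) (hpq : p ≠ q) (hn : ¬ G.Adj p q) (w₀ : G.Walk p q)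
    (hw₀ : ∀ x ∈ w₀.support, x ∈ U ∧ x ≠ r ∧ (G.Adj r x → x = p ∨ x = q)) :
    ∃ C : G.Subgraph, G.IsHole C ∧ C.verts ⊆ U ∧ ∀ x, C.Adj r x ↔ x = p ∨ x = q := by
  classical
  let T : Set V := {x | x ∈ U ∧ x ≠ r ∧ (G.Adj r x → x = p ∨ x = q)}
  have hex : ∃ n, ∃ w : G.Walk p q, (∀ x ∈ w.support, x ∈ T) ∧ w.length = n := ⟨_, w₀, hw₀, rfl⟩
  obtain ⟨w₁, hw₁, hlen₁⟩ := Nat.find_spec hex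
  have hmin₁ : ∀ w' : G.Walk p q, (∀ x ∈ w'.support, x ∈ T) → w₁.length ≤ w'.length :=
    fun w' h => hlen₁ ▸ Nat.find_min' hex ⟨w', h, rfl⟩
  obtain ⟨w, hpath, hw, hmin⟩ : ∃ w : G.Walk p q, w.IsPath ∧ (∀ x ∈ w.support, x ∈ T) ∧
      ∀ w' : G.Walk p q, (∀ x ∈ w'.support, x ∈ T) → w.length ≤ w'.length :=
    ⟨w₁.bypass, w₁.bypass_isPath, fun x hx => hw₁ x (w₁.support_bypass_subset_support hx),
      fun w' h => w₁.length_bypass_le_length.trans (hmin₁ w' h)⟩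
  have hrw : r ∉ w.support := fun h => (hw r h).2.1 rfl
  have hlen : 2 ≤ w.length := by
    by_contra hlt
    have h01 : w.length = 0 ∨ w.length = 1 := by omega
    rcases h01 with h | h
    · exact hpq (Walk.eq_of_length_eq_zero h)
    · exact hn (Walk.adj_of_length_eq_one h)
  let c : G.Walk r r := Walk.cons hrp (w.concat hrq.symm)
  have hedges : ∀ e, e ∈ c.edges ↔ e = s(r, p) ∨ e ∈ w.edges ∨ e = s(q, r) := by
    intro e
    simp [c, Walk.edges_concat]
  have hsupp : ∀ x, x ∈ c.support ↔ x = r ∨ x ∈ w.support := by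
    intro x
    simp only [c, Walk.support_cons, Walk.support_concat, List.mem_cons,
      List.mem_append, List.not_mem_nil, or_false]
    tauto
  have hcyc : c.IsCycle := by
    rw [Walk.cons_isCycle_iff]
    refine ⟨hpath.concat hrw hrq.symm, ?_⟩
    rw [Walk.edges_concat, List.concat_eq_append, List.mem_append, List.mem_singleton]
    rintro (h | h)
    · exact hrw (Walk.fst_mem_support_of_mem_edges _ h)
    · rw [Sym2.eq_swap, Sym2.eq_iff] at h
      rcases h with ⟨h, -⟩ | ⟨h, -⟩
      · exact hpq h
      · exact hrp.ne h.symm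
  have hadj : ∀ x, c.toSubgraph.Adj r x ↔ x = p ∨ x = q := by
    intro x
    rw [Walk.adj_toSubgraph_iff_mem_edges, hedges]
    constructor
    · rintro (h | h | h)
      · exact Or.inl (Sym2.congr_right.1 h)
      · exact absurd (Walk.fst_mem_support_of_mem_edges _ h) hrw
      · rw [Sym2.eq_swap (a := q)] at h
        exact Or.inr (Sym2.congr_right.1 h)
    · rintro (rfl | rfl)
      · exact Or.inl rfl
      · exact Or.inr (Or.inr Sym2.eq_swap)
  refine ⟨c.toSubgraph, ⟨?_, r, c, hcyc, ?_, rfl⟩, ?_, hadj⟩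
  · intro a ha b hb hab
    rw [Walk.mem_verts_toSubgraph, hsupp] at ha hb
    rcases ha with rfl | ha
    · rcases hb with rfl | hb
      · exact absurd rfl hab.ne
      · exact (hadj b).2 ((hw b hb).2.2 hab)
    · rcases hb with rfl | hb
      · exact ((hadj a).2 ((hw a ha).2.2 hab.symm)).symm
      · rw [Walk.adj_toSubgraph_iff_mem_edges, hedges]
        exact Or.inr (Or.inl (w.mem_edges_of_adj_of_length_le hw hmin ha hb hab))
  · simp only [c, Walk.length_cons, Walk.length_concat]
    omega
  · intro x hx
    rw [Walk.mem_verts_toSubgraph, hsupp] at hx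
    rcases hx with rfl | hx
    · exact hr
    · exact (hw x hx).1

/-- Every nonempty finite vertex set `U` contains an *avoidable* vertex `r` of `G[U]`: any two
non-adjacent neighbours of `r` are joined by a walk that otherwise avoids the closed neighbourhood
of `r`. In a chordal graph this says that `r` is simplicial. -/
theorem exists_avoidable (G : SimpleGraph V) (U : Finset V) (hne : U.Nonempty) :
    ∃ r ∈ U, ∀ p ∈ U, ∀ q ∈ U, G.Adj r p → G.Adj r q → p ≠ q → ¬ G.Adj p q →
      ∃ w : G.Walk p q, ∀ x ∈ w.support, x ∈ U ∧ x ≠ r ∧ (G.Adj r x → x = p ∨ x = q) := by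
  classical
  induction U using Finset.strongInduction with
  | H U ih =>
  by_cases hclique : ∀ x ∈ U, ∀ y ∈ U, x ≠ y → G.Adj x y
  · obtain ⟨r, hr⟩ := hne
    exact ⟨r, hr, fun p hp q hq _ _ hpq hn => absurd (hclique p hp q hq hpq) hn⟩
  push Not at hclique
  obtain ⟨s₀, hs₀, u₀, hu₀, hne₀, hn₀⟩ := hclique
  -- `S` is a maximal connected set containing `s₀` that does not dominate `U`.
  let P : Finset V → Prop := fun S => S ⊆ U ∧ s₀ ∈ S ∧
    (∀ s ∈ S, ∃ w : G.Walk s₀ s, ∀ x ∈ w.support, x ∈ S) ∧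
    ∃ u ∈ U, u ∉ S ∧ ∀ s ∈ S, ¬ G.Adj s u
  obtain ⟨S, hSmem, hmax⟩ := (U.powerset.filter P).exists_maximal ⟨{s₀}, by
    simp only [Finset.mem_filter, Finset.mem_powerset, Finset.singleton_subset_iff]
    refine ⟨hs₀, Finset.singleton_subset_iff.2 hs₀, Finset.mem_singleton_self _, ?_,
      u₀, hu₀, ?_, ?_⟩
    · intro s hs
      obtain rfl := Finset.mem_singleton.1 hs
      exact ⟨Walk.nil, by simp⟩
    · simpa using hne₀.symm
    · simpa using hn₀⟩
  obtain ⟨hSU, hs₀S, hconn, u, hu, huS, huadj⟩ := (Finset.mem_filter.1 hSmem).2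
  -- `R` is the set of vertices of `U` not dominated by `S`; it is complete to `N(S)`.
  let R : Finset V := U.filter fun v => v ∉ S ∧ ∀ s ∈ S, ¬ G.Adj s v
  have hRU : R ⊂ U := by
    refine Finset.ssubset_iff_subset_ne.2 ⟨Finset.filter_subset _ _, fun h => ?_⟩
    rw [← h] at hs₀
    exact (Finset.mem_filter.1 hs₀).2.1 hs₀S
  have hcomplete : ∀ b ∈ U, b ∉ S → b ∉ R → ∀ v ∈ R, G.Adj b v := by
    intro b hb hbS hbR v hv
    by_contra hbv
    obtain ⟨hvU, hvS, hvadj⟩ := Finset.mem_filter.1 hv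
    obtain ⟨s, hsS, hsb⟩ : ∃ s ∈ S, G.Adj s b := by
      by_contra! h
      exact hbR (Finset.mem_filter.2 ⟨hb, hbS, h⟩)
    have hvb : v ≠ b := fun h => hbR (h ▸ hv)
    have hP : P (insert b S) := by
      refine ⟨Finset.insert_subset hb hSU, Finset.mem_insert_of_mem hs₀S, ?_, v, hvU, ?_, ?_⟩
      · intro x hx
        rcases Finset.mem_insert.1 hx with rfl | hx
        · obtain ⟨w, hw⟩ := hconn s hsS
          refine ⟨w.concat hsb, fun y hy => ?_⟩
          simp only [Walk.support_concat, List.mem_append, List.mem_singleton] at hy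
          rcases hy with hy | rfl
          · exact Finset.mem_insert_of_mem (hw y hy)
          · exact Finset.mem_insert_self _ _
        · obtain ⟨w, hw⟩ := hconn x hx
          exact ⟨w, fun y hy => Finset.mem_insert_of_mem (hw y hy)⟩
      · simp [hvb, hvS]
      · intro x hx
        rcases Finset.mem_insert.1 hx with rfl | hx
        · exact hbv
        · exact hvadj x hx
    exact hbS (hmax (Finset.mem_filter.2 ⟨Finset.mem_powerset.2 hP.1, hP⟩)
      (Finset.subset_insert _ _) (Finset.mem_insert_self _ _))
  obtain ⟨r, hrR, hr⟩ := ih R hRU ⟨u, Finset.mem_filter.2 ⟨hu, huS, huadj⟩⟩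
  obtain ⟨hrU, hrS, hradj⟩ := Finset.mem_filter.1 hrR
  refine ⟨r, hrU, fun p hp q hq hrp hrq hpq hn => ?_⟩
  have hpS : p ∉ S := fun h => hradj p h hrp.symm
  have hqS : q ∉ S := fun h => hradj q h hrq.symm
  by_cases hpR : p ∈ R
  · by_cases hqR : q ∈ R
    · obtain ⟨w, hw⟩ := hr p hpR q hqR hrp hrq hpq hn
      exact ⟨w, fun x hx => ⟨hRU.1 (hw x hx).1, (hw x hx).2⟩⟩
    · exact absurd (hcomplete q hq hqS hqR p hpR).symm hn
  · by_cases hqR : q ∈ R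
    · exact absurd (hcomplete p hp hpS hpR q hqR) hn
    · -- Both `p` and `q` lie in `N(S)`, and can be joined through `S`.
      have hdom : ∀ b ∈ U, b ∉ S → b ∉ R → ∃ s ∈ S, G.Adj s b := by
        intro b hb hbS hbR
        by_contra! h
        exact hbR (Finset.mem_filter.2 ⟨hb, hbS, h⟩)
      obtain ⟨s, hs, hsp⟩ := hdom p hp hpS hpR
      obtain ⟨t, ht, htq⟩ := hdom q hq hqS hqR
      obtain ⟨w₁, hw₁⟩ := hconn s hs
      obtain ⟨w₂, hw₂⟩ := hconn t ht
      refine ⟨Walk.cons hsp.symm ((w₁.reverse.append w₂).concat htq), fun x hx => ?_⟩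
      have hx' : x = p ∨ x = q ∨ x ∈ S := by
        simp only [Walk.support_cons, Walk.support_concat, List.mem_cons, List.mem_append,
          Walk.mem_support_append_iff, Walk.support_reverse, List.mem_reverse,
          List.not_mem_nil, or_false] at hx
        rcases hx with hx | (hx | hx) | hx
        · exact Or.inl hx
        · exact Or.inr (Or.inr (hw₁ x hx))
        · exact Or.inr (Or.inr (hw₂ x hx))
        · exact Or.inr (Or.inl hx)
      rcases hx' with rfl | rfl | hx'
      · exact ⟨hp, hrp.ne.symm, fun _ => Or.inl rfl⟩
      · exact ⟨hq, hrq.ne.symm, fun _ => Or.inr rfl⟩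
      · exact ⟨hSU hx', fun h => hrS (h ▸ hx'), fun h => absurd h.symm (hradj x hx')⟩

end SimpleGraph

/-! ### Separating coordinates related by a subspace -/

/-- If `W` has dimension `d`, then `d + 1` colours suffice to separate all pairs of coordinates
`p ≠ q` with `e_p - e_q ∈ W`. These pairs form an equivalence relation, and a class with `m`
elements provides `m - 1` independent vectors in `W`. -/
theorem Submodule.exists_coloring_of_single_sub_single_mem {K V : Type*} [Field K] [Finite V]
    [DecidableEq V] (W : Submodule K (V → K)) :
    ∃ c : V → Fin (Module.finrank K W + 1), ∀ p q, p ≠ q →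
      (Pi.single p 1 - Pi.single q 1 : V → K) ∈ W → c p ≠ c q := by
  classical
  have := Fintype.ofFinite V
  let R : Setoid V :=
    { r := fun p q => (Pi.single p 1 - Pi.single q 1 : V → K) ∈ W
      iseqv :=
        ⟨fun p => by simp, fun {p q} h => by simpa using W.neg_mem h,
          fun {p q r} h₁ h₂ => by simpa using W.add_mem h₁ h₂⟩ }
  have hcard : ∀ p₀ : V, Fintype.card {p // R p p₀} ≤ Module.finrank K W + 1 := by
    intro p₀
    have hcard' : Fintype.card {p // R p p₀ ∧ p ≠ p₀} ≤ Module.finrank K W := by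
      let v : {p // R p p₀ ∧ p ≠ p₀} → W := fun p => ⟨_, p.2.1⟩
      have hv : LinearIndependent K v := by
        rw [Fintype.linearIndependent_iff]
        intro g hg i
        have h := congrFun (congrArg Subtype.val hg) i.1
        simpa [v, Pi.single_apply, i.2.2, Subtype.val_inj, Finset.sum_apply] using h
      exact hv.fintype_card_le_finrank
    rw [Fintype.card_subtype] at hcard' ⊢
    refine le_trans (Finset.card_le_card (t := insert p₀ _) fun p hp => ?_)
      ((Finset.card_insert_le _ _).trans (Nat.succ_le_succ hcard'))
    by_cases h : p = p₀
    · simp [h]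
    · simpa [h] using hp
  have hemb : ∀ p₀ : V, ∃ f : {p // R p p₀} → Fin (Module.finrank K W + 1),
      Function.Injective f := fun p₀ => by
    obtain ⟨f⟩ := Function.Embedding.nonempty_of_card_le
      (α := {p // R p p₀}) (β := Fin (Module.finrank K W + 1)) (by simpa using hcard p₀)
    exact ⟨f, f.injective⟩
  choose f hf using hemb
  have hout : ∀ p : V, R p (_root_.Quotient.mk R p).out := fun p =>
    R.symm (_root_.Quotient.mk_out p)
  refine ⟨fun p => f (_root_.Quotient.mk R p).out ⟨p, hout p⟩, fun p q hpq h heq => ?_⟩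
  have hq : _root_.Quotient.mk R p = _root_.Quotient.mk R q := _root_.Quotient.sound h
  have key : ∀ (a b : _root_.Quotient R), a = b → ∀ (ha : R p a.out) (hb : R q b.out),
      f a.out ⟨p, ha⟩ = f b.out ⟨q, hb⟩ → p = q := by
    rintro a _ rfl ha hb e
    exact congrArg Subtype.val (hf _ e)
  exact hpq (key _ _ hq _ _ heq)

namespace SimpleGraph

variable {V : Type*} {G : SimpleGraph V}

/-! ### The hole space of a vertex set -/

/-- The span of the characteristic vectors of the holes of `G` with all vertices in `U`; that is,
the hole space of `G[U]`, inside the edge space of `G`. -/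
noncomputable def holeSpaceOn (G : SimpleGraph V) (U : Set V) :
    Submodule (ZMod 2) (G.edgeSet → ZMod 2) :=
  Submodule.span (ZMod 2) (G.edgeVector '' {C | G.IsHole C ∧ C.verts ⊆ U})

theorem holeSpaceOn_univ (G : SimpleGraph V) : G.holeSpaceOn Set.univ = G.holeSpace := by
  simp [holeSpaceOn, holeSpace, holes]

theorem holeSpaceOn_mono {U U' : Set V} (h : U ⊆ U') : G.holeSpaceOn U ≤ G.holeSpaceOn U' :=
  Submodule.span_mono (Set.image_mono fun _ hC => ⟨hC.1, hC.2.trans h⟩)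

open Classical in
/-- Restriction of an edge vector to the edges at `r`, each indexed by its other end; coordinates at
non-neighbours of `r` are set to zero. -/
noncomputable def starRestrict (G : SimpleGraph V) (r : V) :
    (G.edgeSet → ZMod 2) →ₗ[ZMod 2] (V → ZMod 2) :=
  LinearMap.pi fun p => if h : G.Adj r p then LinearMap.proj ⟨s(r, p), h⟩ else 0

open Classical in
theorem starRestrict_edgeVector (r : V) (C : G.Subgraph) (p : V) :
    G.starRestrict r (G.edgeVector C) p = if C.Adj r p then 1 else 0 := by
  by_cases h : G.Adj r p
  · simp [starRestrict, h, edgeVector]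
  · have : ¬ C.Adj r p := fun h' => h h'.adj_sub
    simp [starRestrict, h, this]

/-- Deleting `r` lowers the dimension of the hole space at least by the dimension of its
projection to the edges at `r`, because holes avoiding `r` project to zero. -/
theorem finrank_holeSpaceOn_diff_add_le [Finite V] (U : Set V) (r : V) :
    Module.finrank (ZMod 2) (G.holeSpaceOn (U \ {r})) +
      Module.finrank (ZMod 2) ((G.holeSpaceOn U).map (G.starRestrict r)) ≤
      Module.finrank (ZMod 2) (G.holeSpaceOn U) := by
  classical
  have hle : G.holeSpaceOn (U \ {r}) ≤ G.holeSpaceOn U := holeSpaceOn_mono Set.sdiff_subset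
  have hker : G.holeSpaceOn (U \ {r}) ≤ LinearMap.ker (G.starRestrict r) := by
    refine Submodule.span_le.2 ?_
    rintro _ ⟨C, ⟨-, hC⟩, rfl⟩
    refine LinearMap.mem_ker.2 (funext fun p => ?_)
    rw [starRestrict_edgeVector, if_neg fun h => (hC (C.edge_vert h)).2 rfl]
    rfl
  have h := ((G.starRestrict r).domRestrict (G.holeSpaceOn U)).finrank_range_add_finrank_ker
  rw [LinearMap.range_domRestrict] at h
  have h2 : Module.finrank (ZMod 2) (G.holeSpaceOn (U \ {r})) ≤
      Module.finrank (ZMod 2)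
        (LinearMap.ker ((G.starRestrict r).domRestrict (G.holeSpaceOn U))) := by
    rw [← (Submodule.comapSubtypeEquivOfLe hle).finrank_eq]
    refine Submodule.finrank_mono fun x hx => ?_
    exact hker hx
  omega

/-- Some vertex `r` of `U` has its neighbourhood in `U` covered by at most `d + 1` cliques, the
colour classes, where `d` is the dimension of the projection of the hole space of `G[U]` to the
edges at `r`. This holds for an avoidable vertex: a non-adjacent pair `p`, `q` of its neighbours
lies on a hole through `r`, which projects to `e_p - e_q`. -/
theorem exists_coloring_neighbors [Finite V] (G : SimpleGraph V) (U : Finset V)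
    (hne : U.Nonempty) :
    ∃ r ∈ U, ∃ c : V → Fin (Module.finrank (ZMod 2) ((G.holeSpaceOn U).map (G.starRestrict r)) + 1),
      ∀ p ∈ U, ∀ q ∈ U, G.Adj r p → G.Adj r q → p ≠ q → c p = c q → G.Adj p q := by
  classical
  obtain ⟨r, hrU, hr⟩ := G.exists_avoidable U hne
  obtain ⟨c, hc⟩ :=
    ((G.holeSpaceOn U).map (G.starRestrict r)).exists_coloring_of_single_sub_single_mem
  refine ⟨r, hrU, c, fun p hp q hq hrp hrq hpq hcpq => ?_⟩
  by_contra hn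
  obtain ⟨w, hw⟩ := hr p hp q hq hrp hrq hpq hn
  obtain ⟨C, hC, hCU, hCr⟩ := exists_isHole_of_walk (U := (U : Set V)) hrU hrp hrq hpq hn w hw
  refine hc p q hpq ⟨G.edgeVector C, Submodule.subset_span ⟨C, ⟨hC, hCU⟩, rfl⟩, ?_⟩ hcpq
  funext x
  rw [starRestrict_edgeVector]
  simp only [hCr, Pi.sub_apply, Pi.single_apply, CharTwo.sub_eq_add]
  by_cases h1 : x = p
  · simp [h1, hpq]
  · simp [h1]

/-! ### Competition models and vertex insertion -/

/-- `G[U]` is the competition graph, on `U`, of an acyclic digraph on `U` together with the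
additional vertices `ι`. The arcs out of `x` are given by `A x`, the additional vertices are
sinks, and acyclicity is witnessed by a function `ρ` decreasing along arcs. -/
def HasCompetitionModel {V : Type*} (G : SimpleGraph V) (U : Set V) (ι : Type) : Prop :=
  ∃ (A : V → V ⊕ ι → Prop) (ρ : V → ℕ),
    (∀ x v, A x (Sum.inl v) → v ∈ U ∧ ρ v < ρ x) ∧
    (∀ x t, A x t → x ∈ U) ∧
    ∀ x ∈ U, ∀ y ∈ U, x ≠ y → (G.Adj x y ↔ ∃ t, A x t ∧ A y t)

/-- Adding back a vertex `r` whose neighbourhood is covered by cliques indexed by `κ`: the vertex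
`r` takes over the role of one additional vertex, and each clique together with `r` gets a new
common out-neighbour. -/
theorem HasCompetitionModel.insert_vertex {U : Set V} {r : V} (hr : r ∈ U) {ι κ : Type}
    (h : G.HasCompetitionModel (U \ {r}) (Option ι)) (c : V → κ)
    (hc : ∀ p ∈ U, ∀ q ∈ U, G.Adj r p → G.Adj r q → p ≠ q → c p = c q → G.Adj p q) :
    G.HasCompetitionModel U (ι ⊕ κ) := by
  obtain ⟨A, ρ, hρ, hA, hadj⟩ := h
  classical
  let B : V → V ⊕ (ι ⊕ κ) → Prop := fun x t => match t with
    | Sum.inl v => if v = r then A x (Sum.inr none) else A x (Sum.inl v)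
    | Sum.inr (Sum.inl i) => A x (Sum.inr (some i))
    | Sum.inr (Sum.inr k) => x = r ∨ x ∈ U ∧ G.Adj r x ∧ c x = k
  have hrA : ∀ t, ¬ A r t := fun t ht => (hA r t ht).2 rfl
  refine ⟨B, fun v => if v = r then 0 else ρ v + 1, ?_, ?_, ?_⟩
  · intro x v hB
    by_cases hv : v = r
    · subst hv
      have hB' : A x (Sum.inr none) := by simpa [B] using hB
      have hx : x ≠ v := fun h => hrA _ (h ▸ hB')
      exact ⟨hr, by simp [hx]⟩
    · have hB' : A x (Sum.inl v) := by simpa [B, hv] using hB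
      have hx : x ≠ r := fun h => hrA _ (h ▸ hB')
      have := hρ x v hB'
      exact ⟨this.1.1, by simpa [hx, hv] using this.2⟩
  · rintro x (v | i | k) hB
    · by_cases hv : v = r
      · exact (hA x (Sum.inr none) (by simpa [B, hv] using hB)).1
      · exact (hA x (Sum.inl v) (by simpa [B, hv] using hB)).1
    · exact (hA x _ hB).1
    · rcases hB with rfl | hB
      · exact hr
      · exact hB.1
  · have hBr : ∀ y ∈ U, r ≠ y → (G.Adj r y ↔ ∃ t, B r t ∧ B y t) := by
      intro y hy hry
      constructor
      · intro h
        exact ⟨Sum.inr (Sum.inr (c y)), Or.inl rfl, Or.inr ⟨hy, h, rfl⟩⟩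
      · rintro ⟨v | i | k, h₁, h₂⟩
        · by_cases hv : v = r
          · exact absurd (by simpa [B, hv] using h₁) (hrA (Sum.inr none))
          · exact absurd (by simpa [B, hv] using h₁) (hrA (Sum.inl v))
        · exact absurd h₁ (hrA _)
        · rcases h₂ with h₂ | h₂
          · exact absurd h₂.symm hry
          · exact h₂.2.1
    intro x hx y hy hxy
    by_cases hxr : x = r
    · subst hxr
      exact hBr y hy hxy
    by_cases hyr : y = r
    · subst hyr
      rw [G.adj_comm, hBr x hx hxy.symm]
      exact exists_congr fun t => and_comm
    rw [hadj x ⟨hx, hxr⟩ y ⟨hy, hyr⟩ hxy]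
    constructor
    · rintro ⟨v | _ | i, h₁, h₂⟩
      · have hv : v ≠ r := (hρ x v h₁).1.2
        exact ⟨Sum.inl v, by simpa [B, hv] using h₁, by simpa [B, hv] using h₂⟩
      · exact ⟨Sum.inl r, by simpa [B] using h₁, by simpa [B] using h₂⟩
      · exact ⟨Sum.inr (Sum.inl i), h₁, h₂⟩
    · rintro ⟨v | i | k, h₁, h₂⟩
      · by_cases hv : v = r
        · exact ⟨Sum.inr none, by simpa [B, hv] using h₁, by simpa [B, hv] using h₂⟩
        · exact ⟨Sum.inl v, by simpa [B, hv] using h₁, by simpa [B, hv] using h₂⟩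
      · exact ⟨Sum.inr (some i), h₁, h₂⟩
      · -- Both vertices lie in the clique numbered `k`.
        have h₁' := h₁.resolve_left hxr
        have h₂' := h₂.resolve_left hyr
        exact (hadj x ⟨hx, hxr⟩ y ⟨hy, hyr⟩ hxy).1
          (hc x hx y hy h₁'.2.1 h₂'.2.1 hxy (h₁'.2.2.trans h₂'.2.2.symm))

theorem HasCompetitionModel.of_injective {U : Set V} {ι κ : Type} (h : G.HasCompetitionModel U ι)
    {f : ι → κ} (hf : Function.Injective f) : G.HasCompetitionModel U κ := by
  obtain ⟨A, ρ, hρ, hA, hadj⟩ := h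
  have hinj : Function.Injective (Sum.map id f : V ⊕ ι → V ⊕ κ) :=
    Sum.map_injective.2 ⟨Function.injective_id, hf⟩
  refine ⟨fun x t => ∃ s, Sum.map id f s = t ∧ A x s, ρ, ?_, ?_, ?_⟩
  · rintro x v ⟨s | i, hs, h⟩
    · obtain rfl : s = v := Sum.inl_injective hs
      exact hρ x s h
    · cases hs
  · rintro x t ⟨s, -, h⟩
    exact hA x s h
  · intro x hx y hy hxy
    rw [hadj x hx y hy hxy]
    constructor
    · rintro ⟨t, h₁, h₂⟩
      exact ⟨_, ⟨t, rfl, h₁⟩, ⟨t, rfl, h₂⟩⟩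
    · rintro ⟨_, ⟨t, rfl, h₁⟩, ⟨t', ht', h₂⟩⟩
      exact ⟨t, h₁, hinj ht' ▸ h₂⟩

/-- The bound `dim H(G[U]) + 1` on the number of additional vertices, by induction on `U`. -/
theorem hasCompetitionModel_holeSpaceOn [Finite V] (G : SimpleGraph V) (U : Finset V) :
    G.HasCompetitionModel U (Fin (Module.finrank (ZMod 2) (G.holeSpaceOn U) + 1)) := by
  classical
  induction U using Finset.strongInduction with
  | H U ih =>
  rcases U.eq_empty_or_nonempty with rfl | hne
  · exact ⟨fun _ _ => False, fun _ => 0, by simp, by simp, by simp⟩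
  obtain ⟨r, hr, c, hc⟩ := G.exists_coloring_neighbors U hne
  have h := ih _ (Finset.erase_ssubset hr)
  rw [Finset.coe_erase] at h
  have h' := (h.of_injective (finSuccEquiv _).injective).insert_vertex
    (Finset.mem_coe.2 hr) c hc
  have hle := finrank_holeSpaceOn_diff_add_le (G := G) (U : Set V) r
  exact (h'.of_injective finSumFinEquiv.injective).of_injective
    (Fin.castLE_injective (by omega))

theorem HasCompetitionModel.isCompetitionGraphWith {k : ℕ}
    (h : G.HasCompetitionModel Set.univ (Fin k)) : G.IsCompetitionGraphWith k := by
  obtain ⟨A, ρ, hρ, -, hadj⟩ := h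
  let D : Digraph (V ⊕ Fin k) := ⟨fun a b => ∃ x, a = Sum.inl x ∧ A x b⟩
  refine ⟨D, ?_, ?_⟩
  · -- Additional vertices are sinks, and `ρ` decreases along arcs between vertices of `G`.
    let σ : V ⊕ Fin k → ℕ := Sum.elim (fun v => ρ v + 1) fun _ => 0
    have hσ : ∀ a b, Relation.TransGen D.Adj a b → σ b < σ a := by
      have hstep : ∀ a b, D.Adj a b → σ b < σ a := by
        rintro _ (v | i) ⟨x, rfl, hx⟩
        · exact Nat.succ_lt_succ (hρ x v hx).2
        · exact Nat.succ_pos _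
      intro a b hab
      induction hab with
      | single h => exact hstep _ _ h
      | tail _ h ih => exact (hstep _ _ h).trans ih
    exact fun v hv => lt_irrefl _ (hσ v v hv)
  · ext a b
    constructor
    · rintro ⟨hne, t, ⟨x, rfl, hx⟩, ⟨y, rfl, hy⟩⟩
      exact (hadj x trivial y trivial fun h => hne (congrArg _ h)).2 ⟨t, hx, hy⟩
    · intro h
      rcases a with x | i <;> rcases b with y | j
      · have hxy : G.Adj x y := h
        obtain ⟨t, hx, hy⟩ := (hadj x trivial y trivial hxy.ne).1 hxy
        exact ⟨fun e => hxy.ne (Sum.inl_injective e), t, ⟨x, rfl, hx⟩, ⟨y, rfl, hy⟩⟩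
      · simp at h
      · simp at h
      · simp at h

/-! ### Bounds on the competition number -/

theorem competitionNumber_le_finrank_holeSpace_add_one [Finite V] (G : SimpleGraph V) :
    G.competitionNumber ≤ Module.finrank (ZMod 2) G.holeSpace + 1 := by
  classical
  have := Fintype.ofFinite V
  have h := G.hasCompetitionModel_holeSpaceOn Finset.univ
  rw [Finset.coe_univ, holeSpaceOn_univ] at h
  exact Nat.sInf_le h.isCompetitionGraphWith

/-- A finite acyclic digraph has a sink, and a sink is isolated in the competition graph. -/
theorem competitionNumber_pos [Finite V] [Nonempty V] (h : ∀ v : V, ¬ G.IsIsolated v) :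
    0 < G.competitionNumber := by
  rw [Nat.pos_iff_ne_zero]
  intro h0
  obtain ⟨D, hD, hG⟩ : G.IsCompetitionGraphWith 0 := h0 ▸ G.isLeast_competitionNumber.1
  have : Std.Irrefl (Relation.TransGen (flip D.Adj)) :=
    ⟨fun v hv => hD v (Relation.transGen_swap.1 hv)⟩
  have hwf : WellFounded (Relation.TransGen (flip D.Adj)) :=
    Finite.wellFounded_of_trans_of_irrefl _
  -- A minimal element for the reversed arcs is a sink.
  obtain ⟨a, -, ha⟩ := hwf.has_min Set.univ ⟨Sum.inl (Classical.arbitrary V), trivial⟩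
  rcases a with v | i
  · refine h v fun u hu => ?_
    have hvu : D.competitionGraph.Adj (Sum.inl v) (Sum.inl u) := hG ▸ hu
    obtain ⟨-, t, ht, -⟩ := hvu
    exact ha t trivial (Relation.TransGen.single ht)
  · exact i.elim0

theorem IsChordal.holeSpace_eq_bot (h : G.IsChordal) : G.holeSpace = ⊥ := by
  rw [holeSpace, Set.eq_empty_of_forall_notMem (s := G.holes) h, Set.image_empty,
    Submodule.span_empty]

end SimpleGraph

theorem mainTheorem6 {V : Type*} [Finite V] (G : SimpleGraph V) :
    (G.holes.encard ≤ 2 →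
      G.competitionNumber ≤ Module.finrank (ZMod 2) G.holeSpace + 1) ∧
    (Nonempty V → G.IsChordal → (∀ v : V, ¬ G.IsIsolated v) →
      G.competitionNumber = Module.finrank (ZMod 2) G.holeSpace + 1) := by
  have hle := G.competitionNumber_le_finrank_holeSpace_add_one
  refine ⟨fun _ => hle, fun _ hG h => le_antisymm hle ?_⟩
  rw [hG.holeSpace_eq_bot, finrank_bot]
  exact SimpleGraph.competitionNumber_pos h
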